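/- Let $\mathbb k$ be an algebraically closed field of characteristic zero, let $\mathfrak g$ be a finite-dimensional Lie algebra over $\mathbb k$ and let $V$ be a finite-dimensional $\mathfrak g$-module (for example, $\mathfrak g$ is the Lie algebra of a connected affine algebraic group $G$, and $V$ is a finite-dimensional rational $G$-module). For finite-dimensional vector spaces $V$, $N$ let $\mathrm{Mor}(V,N)$ be the $\mathbb k[V]$-module of polynomial maps $V\to N$. For $v\in V$ put $\mathfrak g_v=\{x\in\mathfrak g\mid x\cdot v=0\}$ and $\mathfrak g\cdot v=\{x\cdot v\mid x\in\mathfrak g\}$, and let $$V_{reg}=\{v\in V\mid \dim\mathfrak g_v\le\dim\mathfrak g_{w}\ \text{for all } w\in V\},$$ which is a dense Zariski-open subset of $V$. Define the homomorphism of $\mathbb k[V]$-modules $\hat\phi:\mathrm{Mor}(V,\mathfrak g)\to\mathrm{Mor}(V,V)$ by $\hat\phi(F)(v)=F(v)\cdot v$. Suppose that the vector bundle $E'_\phi=\{(v,x)\mid v\in V_{reg},\ x\in\mathfrak g_v\}\subset V_{reg}\times\mathfrak g$ over $V_{reg}$ is trivial as an algebraic vector bundle, and that $\operatorname{codim}_V(V\setminus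 V_{reg})\ge 3$ (this holds by convention if $V\setminus V_{reg}$ is empty). Then $$\operatorname{Im}\hat\phi=\{\mathcal F\in\mathrm{Mor}(V,V)\mid \mathcal F(v)\in\mathfrak g\cdot v\ \text{ for all } v\in V\}.$$ Moreover, if $\mathcal F\in\mathrm{Mor}(V,V)$ satisfies $\mathcal F(v)\in\mathfrak g\cdot v$ for all $v\in V_{reg}$, then there is $F\in\mathrm{Mor}(V,\mathfrak g)$ such that $\mathcal F(v)=F(v)\cdot v$ for all $v\in V$. -/

import Mathlib

namespace AdjointFields

section Poly

variable (k : Type*) [Field k] (V : Type*) [AddCommGroup V] [Module k V]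

/-- The algebra `k[V]` of polynomial functions on the `k`-vector space `V`: the subalgebra of
all functions `V → k` that is generated by the linear forms. -/
def PolyFun : Subalgebra k (V → k) :=
  Algebra.adjoin k (Set.range fun l : Module.Dual k V => (l : V → k))

/-- `Mor(V, N)`: the `k[V]`-module of polynomial maps `V → N` (maps all of whose coordinates are
polynomial functions), with `(f • F)(v) = f(v) • F(v)`. -/
def Mor (N : Type*) [AddCommGroup N] [Module k N] : Submodule (PolyFun k V) (V → N) where
  carrier := {F | ∀ l : Module.Dual k N, (fun v => l (F v)) ∈ PolyFun k V}
  zero_mem' l := by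
    have h : (fun v : V => l ((0 : V → N) v)) = 0 := by ext v; simp
    rw [h]
    exact Subalgebra.zero_mem _
  add_mem' {F F'} hF hF' l := by
    have h : (fun v : V => l ((F + F') v)) = (fun v => l (F v)) + fun v => l (F' v) := by
      ext v; simp
    rw [h]
    exact Subalgebra.add_mem _ (hF l) (hF' l)
  smul_mem' f F hF l := by
    have h : (fun v : V => l ((f • F) v)) = (f : V → k) * fun v => l (F v) := by
      ext v
      exact l.map_smul ((f : V → k) v) (F v)
    rw [h]
    exact Subalgebra.mul_mem _ f.2 (hF l)

/-- The ideal of `k[V]` of all polynomial functions that vanish on the subset `Z` of `V`. -/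
def vanishingIdeal (Z : Set V) : Ideal (PolyFun k V) where
  carrier := {f | ∀ z ∈ Z, (f : V → k) z = 0}
  zero_mem' _ _ := rfl
  add_mem' {f f'} hf hf' z hz := by
    change (f : V → k) z + (f' : V → k) z = 0
    rw [hf z hz, hf' z hz, add_zero]
  smul_mem' f f' hf' z hz := by
    change (f : V → k) z * (f' : V → k) z = 0
    rw [hf' z hz, mul_zero]

/-- The codimension in `V` of a Zariski closed subset `Z`: the height of its ideal, that is, the
least codimension of an irreducible component of `Z` (and `⊤` if `Z` is empty). -/
noncomputable def codim (Z : Set V) : ℕ∞ := (vanishingIdeal k V Z).height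

variable {V}

/-- `f` is a regular function on the Zariski open subset `U` of `V`: near every point of `U`
it is a quotient of two polynomial functions. (The values of `f` outside `U` are irrelevant.) -/
def IsRegularFunOn (U : Set V) (f : V → k) : Prop :=
  ∀ u ∈ U, ∃ p ∈ PolyFun k V, ∃ q ∈ PolyFun k V, q u ≠ 0 ∧
    ∀ w ∈ U, q w ≠ 0 → f w = p w / q w

variable {N : Type*} [AddCommGroup N] [Module k N]

/-- `s` is a morphism of varieties from the Zariski open subset `U` of `V` to the vector
space `N`: all its coordinates are regular functions on `U`. -/
def IsRegularMapOn (U : Set V) (s : V → N) : Prop :=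
  ∀ l : Module.Dual k N, IsRegularFunOn k U fun v => l (s v)

/-- The sub-bundle `{(v, x) | v ∈ U, x ∈ E v}` of the product bundle `U × N` is trivial as an
algebraic vector bundle: it has a global frame of regular sections `s₁, …, sₘ`, equivalently
`(v, c) ↦ (v, ∑ cᵢ sᵢ(v))` is an isomorphism of `U × kᵐ` with it. -/
def IsTrivialSubbundle (U : Set V) (E : V → Submodule k N) : Prop :=
  ∃ (m : ℕ) (s : Fin m → V → N), (∀ i, IsRegularMapOn k U (s i)) ∧
    ∀ v ∈ U, LinearIndependent k (fun i => s i v) ∧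
      Submodule.span k (Set.range fun i => s i v) = E v

end Poly

section Rep

variable (k : Type*) [Field k] (g : Type*) [LieRing g] [LieAlgebra k g]
  {V : Type*} [AddCommGroup V] [Module k V] [LieRingModule g V] [LieModule k g V]

/-- The linear map `g → V`, `x ↦ x · v`. -/
def orbitMap (v : V) : g →ₗ[k] V where
  toFun x := ⁅x, v⁆
  map_add' x y := add_lie x y v
  map_smul' c x := smul_lie c x v

/-- The stabiliser `g_v = {x ∈ g | x · v = 0}`. -/
def stabiliser (v : V) : Submodule k g := LinearMap.ker (orbitMap k g v)

/-- The subspace `g · v = {x · v | x ∈ g}` of `V`. -/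
def tangent (v : V) : Submodule k V := LinearMap.range (orbitMap k g v)

variable (V)

/-- The set `V_reg` of regular elements: those whose stabiliser has minimal dimension. -/
def regularSet : Set V :=
  {v | ∀ w : V, Module.finrank k (stabiliser k g v) ≤ Module.finrank k (stabiliser k g w)}

theorem lie_mem_mor [Module.Finite k g] {F : V → g} (hF : F ∈ Mor k V g) :
    (fun v => ⁅F v, v⁆) ∈ Mor k V V := by
  intro l
  let b := Module.finBasis k g
  have h : (fun v : V => l ⁅F v, v⁆) = ∑ i, (fun v => b.coord i (F v)) *
      ((l ∘ₗ (LieModule.toEnd k g V (b i)) : Module.Dual k V) : V → k) := by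
    ext v
    have hs : ⁅F v, v⁆ = ∑ i, b.coord i (F v) • ⁅b i, v⁆ := by
      have := congrArg (orbitMap k g v) (b.sum_repr (F v))
      rw [map_sum] at this
      simp only [map_smul] at this
      exact this.symm
    simp [hs]
  rw [h]
  exact Subalgebra.sum_mem _ fun i _ =>
    Subalgebra.mul_mem _ (hF (b.coord i)) (Algebra.subset_adjoin ⟨_, rfl⟩)

/-- The homomorphism of `k[V]`-modules `φ̂ : Mor(V, g) → Mor(V, V)`, `φ̂(F)(v) = F(v) · v`. -/
def phiHat [Module.Finite k g] : Mor k V g →ₗ[PolyFun k V] Mor k V V where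
  toFun F := ⟨fun v => ⁅F.1 v, v⁆, lie_mem_mor k g V F.2⟩
  map_add' F F' := by
    ext v
    exact add_lie (F.1 v) (F'.1 v) v
  map_smul' f F := by
    ext v
    exact smul_lie ((f : V → k) v) (F.1 v) v

end Rep

end AdjointFields

/-! In bases of `g` and `V`, the map `phiHat` is a matrix `A` of linear forms over the polynomial
ring `R = k[V]`. Let `U` be the regular set. A frame of the stabiliser bundle is regular on `U`, so
by a Hartogs argument its entries are polynomials. They form a matrix `S`, and 0 → R^m → R^ι → R^n
with maps `S` and `A` is exact: `S` is injective and ker A = im S.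

Let `F` be pointwise in the image of `A` over `U`. The rank of `A` is constant there, so Cramer's
rule solves `A G = q F` with `q` nonzero at any prescribed point of `U`. The ideal of all such `q`
therefore has its zeros outside `U`, and by the Nullstellensatz its height is at least 3. A
polynomial ring is Cohen–Macaulay, so the ideal contains a weakly regular sequence `a, b, c`. The
local solutions for `a`, `b`, `c` differ by elements of im S. They can be corrected to agree because
H² of the free module R^m with supports in an ideal of grade at least 3 vanishes; this is done by
hand in `IsWeaklyRegular.mem_range_of_exact`. The same scheme with two elements gives ker A = im S
and the Hartogs extension. -/

namespace AdjointFields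

/-! ### Nagata's change of variables -/

section Nagata

open MvPolynomial List

variable {k : Type*} [Field k] {n : ℕ}

/-- The algebra endomorphism `X₀ ↦ X₀`, `Xᵢ ↦ Xᵢ + c X₀ ^ (u ^ i)` of the polynomial ring. -/
noncomputable def nagataHom (u : ℕ) (c : k) :
    MvPolynomial (Fin (n + 1)) k →ₐ[k] MvPolynomial (Fin (n + 1)) k :=
  aeval fun i ↦ if i = 0 then X 0 else X i + c • X 0 ^ (u ^ i.1)

theorem nagataHom_comp_neg (u : ℕ) (c : k) :
    (nagataHom (n := n) u c).comp (nagataHom u (-c)) = AlgHom.id _ _ := by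
  rw [nagataHom, nagataHom, comp_aeval, ← MvPolynomial.aeval_X_left]
  ext i v
  cases i using Fin.cases <;> simp

/-- Nagata's change of variables `X₀ ↦ X₀`, `Xᵢ ↦ Xᵢ + X₀ ^ (u ^ i)`. -/
noncomputable def nagataEquiv (u : ℕ) :
    MvPolynomial (Fin (n + 1)) k ≃ₐ[k] MvPolynomial (Fin (n + 1)) k :=
  AlgEquiv.ofAlgHom (nagataHom u 1) (nagataHom u (-1))
    (nagataHom_comp_neg u 1) (by simpa using nagataHom_comp_neg (k := k) u (-1))

theorem finSuccEquiv_nagataEquiv_X (u : ℕ) (i : Fin (n + 1)) :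
    finSuccEquiv k n (nagataEquiv u (X i)) = Fin.cases Polynomial.X
      (fun j => Polynomial.X ^ (u ^ (j.succ : Fin (n + 1)).1) + Polynomial.C (X j)) i := by
  cases i using Fin.cases <;>
    simp [nagataEquiv, nagataHom, finSuccEquiv_X_zero, finSuccEquiv_X_succ, add_comm]

theorem monic_finSuccEquiv_nagataEquiv_X {u : ℕ} (hu : u ≠ 0) (i : Fin (n + 1)) :
    (finSuccEquiv k n (nagataEquiv u (X i))).Monic := by
  rw [finSuccEquiv_nagataEquiv_X]
  cases i using Fin.cases with
  | zero => exact Polynomial.monic_X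
  | succ j => exact Polynomial.monic_X_pow_add_C _ (pow_ne_zero _ hu)

theorem natDegree_finSuccEquiv_nagataEquiv_X (u : ℕ) (i : Fin (n + 1)) :
    (finSuccEquiv k n (nagataEquiv u (X i))).natDegree = u ^ i.1 := by
  rw [finSuccEquiv_nagataEquiv_X]
  cases i using Fin.cases with
  | zero => simp
  | succ j => exact Polynomial.natDegree_X_pow_add_C

theorem finSuccEquiv_nagataEquiv_monomial (u : ℕ) (v : Fin (n + 1) →₀ ℕ) (a : k) :
    finSuccEquiv k n (nagataEquiv u (monomial v a)) =
      Polynomial.C (C a) * ∏ i, finSuccEquiv k n (nagataEquiv u (X i)) ^ v i := by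
  rw [monomial_eq, Finsupp.prod_pow v fun a ↦ X a, map_mul, map_mul, map_prod, map_prod]
  simp only [map_pow]
  congr 1
  rw [← algebraMap_eq, AlgEquiv.commutes, AlgEquiv.commutes]
  rfl

theorem monic_prod_nagataEquiv_X {u : ℕ} (hu : u ≠ 0) (v : Fin (n + 1) →₀ ℕ) :
    (∏ i, finSuccEquiv k n (nagataEquiv u (X i)) ^ v i).Monic :=
  Polynomial.monic_prod_of_monic _ _ fun i _ => (monic_finSuccEquiv_nagataEquiv_X hu i).pow _

theorem degree_finSuccEquiv_nagataEquiv_monomial {u : ℕ} (hu : u ≠ 0) (v : Fin (n + 1) →₀ ℕ)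
    {a : k} (ha : a ≠ 0) : (finSuccEquiv k n (nagataEquiv u (monomial v a))).degree =
      ((∑ i : Fin (n + 1), v i * u ^ i.1 : ℕ) : WithBot ℕ) := by
  have hC : (C a : MvPolynomial (Fin n) k) ≠ 0 := by simpa using ha
  have hm := monic_prod_nagataEquiv_X (k := k) hu v
  rw [finSuccEquiv_nagataEquiv_monomial, Polynomial.degree_C_mul hC,
    Polynomial.degree_eq_natDegree hm.ne_zero,
    Polynomial.natDegree_prod_of_monic _ _ fun i _ =>
      (monic_finSuccEquiv_nagataEquiv_X hu i).pow _]
  simp only [Polynomial.natDegree_pow, natDegree_finSuccEquiv_nagataEquiv_X]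

theorem leadingCoeff_finSuccEquiv_nagataEquiv_monomial {u : ℕ} (hu : u ≠ 0)
    (v : Fin (n + 1) →₀ ℕ) (a : k) :
    (finSuccEquiv k n (nagataEquiv u (monomial v a))).leadingCoeff = C a := by
  rw [finSuccEquiv_nagataEquiv_monomial, Polynomial.leadingCoeff_mul,
    (monic_prod_nagataEquiv_X hu v).leadingCoeff, Polynomial.leadingCoeff_C, mul_one]

/-- The exponents are the base `u` digits of the sum, so distinct monomials acquire distinct
degrees. -/
theorem sum_mul_pow_ne {u : ℕ} (hu : 1 < u) {v w : Fin (n + 1) →₀ ℕ} (hv : ∀ i, v i < u)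
    (hw : ∀ i, w i < u) (ne : v ≠ w) :
    ∑ i : Fin (n + 1), v i * u ^ i.1 ≠ ∑ i : Fin (n + 1), w i * u ^ i.1 := by
  intro h
  refine ne <| Finsupp.ext <| congrFun <| ofFn_inj.mp ?_
  apply Nat.ofDigits_inj_of_len_eq hu (by simp) (List.forall_mem_ofFn_iff.mpr hv)
    (List.forall_mem_ofFn_iff.mpr hw)
  simpa only [Nat.ofDigits_eq_sum_mapIdx, mapIdx_eq_ofFn, get_ofFn, length_ofFn,
    Fin.val_cast, sum_ofFn] using! h

/-- Every nonzero polynomial in `n + 1` variables becomes, up to a unit, monic in one variable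
after a suitable automorphism. -/
theorem exists_algEquiv_isUnit_leadingCoeff {f : MvPolynomial (Fin (n + 1)) k} (hf : f ≠ 0) :
    ∃ e : MvPolynomial (Fin (n + 1)) k ≃ₐ[k] Polynomial (MvPolynomial (Fin n) k),
      IsUnit (e f).leadingCoeff := by
  -- This exceeds 1 and every exponent occurring in `f`, as uniqueness of base `u` digits requires.
  let u := 2 + f.totalDegree
  have hu : u ≠ 0 := by omega
  refine ⟨(nagataEquiv u).trans (finSuccEquiv k n), ?_⟩
  have hlt : ∀ v ∈ f.support, ∀ i, v i < u := fun v hv i =>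
    lt_of_le_of_lt ((monomial_le_degreeOf i hv).trans (degreeOf_le_totalDegree f i)) (by omega)
  set h : (Fin (n + 1) →₀ ℕ) → Polynomial (MvPolynomial (Fin n) k) := fun w ↦
    finSuccEquiv k n (nagataEquiv u (monomial w (coeff w f))) with h_def
  have hdeg : ∀ w ∈ f.support, (h w).degree =
      ((∑ i : Fin (n + 1), w i * u ^ i.1 : ℕ) : WithBot ℕ) := fun w hw =>
    degree_finSuccEquiv_nagataEquiv_monomial hu w (mem_support_iff.mp hw)
  obtain ⟨v, vin, vs⟩ := Finset.exists_max_image f.support (fun v ↦ (h v).degree)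
    (support_nonempty.mpr hf)
  have hs : ((nagataEquiv u).trans (finSuccEquiv k n)) f = (∑ w ∈ f.support.erase v, h w) + h v := by
    rw [Finset.sum_erase_add _ _ vin, h_def, ← map_sum, ← map_sum, f.support_sum_monomial_coeff]
    rfl
  have hv0 : coeff v f ≠ 0 := mem_support_iff.mp vin
  rw [hs, Polynomial.leadingCoeff_add_of_degree_lt,
    leadingCoeff_finSuccEquiv_nagataEquiv_monomial hu]
  · exact hv0.isUnit.map C
  · refine (Polynomial.degree_sum_le _ _).trans_lt ((Finset.sup_lt_iff ?_).mpr fun w hw => ?_)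
    · rw [hdeg v vin]; exact WithBot.bot_lt_coe _
    · have hw' := Finset.mem_of_mem_erase hw
      refine lt_of_le_of_ne (vs w hw') ?_
      rw [hdeg v vin, hdeg w hw']
      exact fun h => sum_mul_pow_ne (by omega) (hlt w hw') (hlt v vin) (Finset.ne_of_mem_erase hw)
        (by exact_mod_cast h)

end Nagata

/-! ### Height and regular sequences in polynomial rings -/

section Grade

open Polynomial

/-- Inverting the nonzero constants preserves the height of `P` and leads to `K[X]`, which has
dimension one. -/
theorem height_le_one_of_comap_C_eq_bot {D : Type*} [CommRing D] [IsDomain D]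
    (P : Ideal D[X]) [P.IsPrime] (hP : P.comap C = ⊥) : P.height ≤ 1 := by
  let K := FractionRing D
  let : Algebra D[X] K[X] := Polynomial.algebra D K
  have : IsLocalization ((nonZeroDivisors D).map C) K[X] := Polynomial.isLocalization _ K
  have disj : Disjoint (((nonZeroDivisors D).map (C : D →+* D[X]) : Submonoid D[X]) : Set D[X])
      (P : Set D[X]) := by
    rw [Set.disjoint_left]
    rintro _ ⟨b, hb, rfl⟩ hbP
    have : b ∈ P.comap C := hbP
    rw [hP, Ideal.mem_bot] at this
    exact nonZeroDivisors.ne_zero hb this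
  rw [← IsLocalization.height_map_of_disjoint ((nonZeroDivisors D).map C) P disj (S := K[X])]
  have hprime := IsLocalization.isPrime_of_isPrime_disjoint
    ((nonZeroDivisors D).map (C : D →+* D[X])) K[X] P ‹_› disj
  have h := Ideal.height_le_ringKrullDim_of_isPrime (I := P.map (algebraMap D[X] K[X]))
  rw [Polynomial.ringKrullDim_of_isNoetherianRing, ringKrullDim_eq_zero_of_field, zero_add] at h
  exact_mod_cast h

/-- The height of `P` is at most that of its contraction `p` plus that of its image in `(R ⧸ p)[X]`.
This image contracts to zero, so the previous bound applies. -/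
theorem height_le_height_comap_C_add_one {R : Type*} [CommRing R] [IsNoetherianRing R]
    (P : Ideal R[X]) [P.IsPrime] : P.height ≤ (P.comap C).height + 1 := by
  set p := P.comap C with hp
  have : P.LiesOver p := ⟨rfl⟩
  have : p.IsPrime := Ideal.comap_isPrime _ _
  refine (Ideal.height_le_height_add_of_liesOver p P).trans (add_le_add le_rfl ?_)
  let e : (R[X] ⧸ (p.map (algebraMap R R[X]))) ≃+* (R ⧸ p)[X] :=
    (Ideal.polynomialQuotientEquivQuotientPolynomial p).symm
  have hle : p.map (algebraMap R R[X]) ≤ P := Ideal.map_le_iff_le_comap.mpr le_rfl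
  have : (P.map (Ideal.Quotient.mk (p.map (algebraMap R R[X])))).IsPrime :=
    Ideal.map_isPrime_of_surjective Ideal.Quotient.mk_surjective (by rwa [Ideal.mk_ker])
  rw [← e.height_map]
  have := Ideal.map_isPrime_of_equiv e (I := P.map (Ideal.Quotient.mk (p.map (algebraMap R R[X]))))
  apply height_le_one_of_comap_C_eq_bot
  rw [eq_bot_iff]
  intro x hx
  obtain ⟨x, rfl⟩ := Ideal.Quotient.mk_surjective x
  rw [Ideal.mem_bot, Ideal.Quotient.eq_zero_iff_mem]
  have hx' : C (Ideal.Quotient.mk p x) ∈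
    (P.map (Ideal.Quotient.mk (p.map (algebraMap R R[X])))).map e := hx
  have he : C (Ideal.Quotient.mk p x) = e (Ideal.Quotient.mk _ (C x)) := by
    rw [RingEquiv.eq_symm_apply]
    exact (Ideal.polynomialQuotientEquivQuotientPolynomial_map_mk p (C x)).symm ▸ by simp
  rw [he, Ideal.mem_map_of_equiv] at hx'
  obtain ⟨y, hy, hxy⟩ := hx'
  rw [e.injective hxy] at hy
  exact (Ideal.mem_quotient_iff_mem hle).mp hy

/-- If `J` contains a monic polynomial, then contracting `J` to the coefficients lowers
the height by at most one. -/
theorem height_le_height_comap_C_of_monic {R : Type*} [CommRing R] [IsNoetherianRing R]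
    (J : Ideal R[X]) {a : R[X]} (ha : a.Monic) (haJ : a ∈ J) :
    J.height ≤ (J.comap C).height + 1 := by
  rw [Ideal.height_eq_inf_minimalPrimes (J.comap C), ENat.iInf_add]
  refine le_iInf fun p => ?_
  by_cases hp : p ∈ (J.comap C).minimalPrimes
  swap
  · simp [hp]
  simp only [hp, iInf_pos]
  have := hp.isPrime
  have := ha.finite_quotient
  -- Since `R[X] ⧸ (a)` is finite over `R`, lying over gives a prime above `p` that contains the
  -- image of `J`.
  obtain ⟨Q, hQ, hQp, hQc⟩ := Ideal.exists_ideal_over_prime_of_isIntegral p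
    (J.map (Ideal.Quotient.mk (Ideal.span {a}))) (by
      intro x hx
      refine hp.1.2 ?_
      have hx' : Ideal.Quotient.mk (Ideal.span {a}) (C x) ∈
        J.map (Ideal.Quotient.mk (Ideal.span {a})) := hx
      exact (Ideal.mem_quotient_iff_mem ((Ideal.span_singleton_le_iff_mem _).mpr haJ)).mp hx')
  have h1 : J ≤ Q.comap (Ideal.Quotient.mk (Ideal.span {a})) := Ideal.map_le_iff_le_comap.mp hQ
  refine (Ideal.height_mono h1).trans ((height_le_height_comap_C_add_one _).trans (le_of_eq ?_))
  congr 2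

/-- Needed for polynomial rings without variables, where a nonzero ideal is the unit ideal. Weak
regularity allows the quotients to vanish. -/
theorem isWeaklyRegular_replicate_one {R : Type*} [CommRing R] (t : ℕ) (M : Type*)
    [AddCommGroup M] [Module R M] :
    RingTheory.Sequence.IsWeaklyRegular M (List.replicate t (1 : R)) := by
  induction t generalizing M with
  | zero => exact .nil _ _
  | succ t ih =>
    exact .cons (IsSMulRegular.one M) (ih _)

/-- For monic `a` the quotient `R[X] ⧸ (a)` is free over `R`, and flat base change preserves weak
regularity. -/
theorem isWeaklyRegular_cons_map_C {R : Type*} [CommRing R] {a : R[X]} (ha : a.Monic)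
    {rs : List R} (h : RingTheory.Sequence.IsWeaklyRegular R rs) :
    RingTheory.Sequence.IsWeaklyRegular R[X] (a :: rs.map C) := by
  refine .cons ?_ ?_
  · exact fun x y hxy => ha.isRegular.left hxy
  · have := ha.free_quotient
    have h1 := h.of_flat (S := R[X] ⧸ Ideal.span {a})
    rw [RingTheory.Sequence.isWeaklyRegular_map_algebraMap_iff] at h1
    let e : QuotSMulTop a R[X] ≃ₗ[R[X]] R[X] ⧸ Ideal.span {a} :=
      Submodule.quotEquivOfEq _ _ (by
        rw [← Submodule.ideal_span_singleton_smul, smul_eq_mul, Ideal.mul_top])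
    rw [e.isWeaklyRegular_congr]
    rwa [← algebraMap_eq, RingTheory.Sequence.isWeaklyRegular_map_algebraMap_iff]

/-- In a polynomial ring over a field, an ideal of height at least `t` contains a weakly regular
sequence of length `t`. -/
theorem exists_isWeaklyRegular_of_le_height {k : Type*} [Field k] (t : ℕ) {n : ℕ}
    (I : Ideal (MvPolynomial (Fin n) k)) (hI : (t : ℕ∞) ≤ I.height) :
    ∃ rs : List (MvPolynomial (Fin n) k), rs.length = t ∧ (∀ r ∈ rs, r ∈ I) ∧
      RingTheory.Sequence.IsWeaklyRegular (MvPolynomial (Fin n) k) rs := by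
  induction t generalizing n with
  | zero => exact ⟨[], rfl, by simp, .nil _ _⟩
  | succ t ih =>
    have hI0 : I ≠ ⊥ := by
      rintro rfl
      rw [Ideal.height_bot] at hI
      simp at hI
    obtain ⟨f, hfI, hf⟩ := Submodule.exists_mem_ne_zero_of_ne_bot hI0
    cases n with
    | zero =>
      refine ⟨List.replicate (t + 1) 1, by simp, fun r hr => ?_, isWeaklyRegular_replicate_one _ _⟩
      rw [List.eq_of_mem_replicate hr]
      have hu : IsUnit f := by
        rw [MvPolynomial.eq_C_of_isEmpty f] at hf ⊢
        have : MvPolynomial.coeff 0 f ≠ 0 := fun h => hf (by rw [h, map_zero])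
        exact this.isUnit.map MvPolynomial.C
      rw [Ideal.eq_top_of_isUnit_mem I hfI hu]
      trivial
    | succ n =>
      -- The monic element of the transported ideal starts the sequence and costs one unit of
      -- height. The rest comes from the contraction to one variable fewer.
      obtain ⟨e, he⟩ := exists_algEquiv_isUnit_leadingCoeff hf
      let J := I.map (e : MvPolynomial (Fin (n + 1)) k ≃+* (MvPolynomial (Fin n) k)[X])
      have hJ : J.height = I.height := RingEquiv.height_map _ I
      have hefJ : e f ∈ J := Ideal.mem_map_of_mem _ hfI
      obtain ⟨a, ha, haJ⟩ : ∃ a : (MvPolynomial (Fin n) k)[X], a.Monic ∧ a ∈ J :=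
        ⟨_, monic_of_isUnit_leadingCoeff_inv_smul he,
          Submodule.smul_of_tower_mem J he.unit⁻¹.val hefJ⟩
      have h1 := height_le_height_comap_C_of_monic J ha haJ
      rw [hJ] at h1
      have h2 : (t : ℕ∞) ≤ (J.comap C).height := by
        have := hI.trans h1
        push_cast at this
        exact (ENat.add_le_add_iff_right (by simp)).mp this
      obtain ⟨rs, hlen, hrs, hreg⟩ := ih (J.comap C) h2
      have hreg' := isWeaklyRegular_cons_map_C ha hreg
      refine ⟨(a :: rs.map C).map e.symm, by simp [hlen], ?_, ?_⟩
      · intro r hr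
        obtain ⟨s, hs, rfl⟩ := List.mem_map.mp hr
        have hsJ : s ∈ J := by
          rcases List.mem_cons.mp hs with rfl | hs
          · exact haJ
          · obtain ⟨s', hs', rfl⟩ := List.mem_map.mp hs
            exact hrs s' hs'
        obtain ⟨x, hx, rfl⟩ := (Ideal.mem_map_of_equiv _ _).mp hsJ
        have hex : e.symm (e x) = x := e.symm_apply_apply x
        exact hex.symm ▸ hx
      · refine (AddEquiv.isWeaklyRegular_congr (e := e.symm.toRingEquiv.toAddEquiv) ?_).mp hreg'
        rw [List.forall₂_map_right_iff, List.forall₂_same]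
        intro r _ x
        exact map_mul e.symm r x

end Grade

/-! ### Saturation of images of maps between free modules -/

section Saturation

open RingTheory.Sequence

variable {R : Type*} [CommRing R] {ι κ μ : Type*} {a b c : R}

theorem IsWeaklyRegular.smul_left_injective_pi {l : List R} (h : IsWeaklyRegular R (a :: l))
    {x y : ι → R} (hxy : a • x = a • y) : x = y := by
  ext i
  exact ((isWeaklyRegular_cons_iff _ _ _).mp h).1 (congrFun hxy i)

/-- Multiplication by `b` is injective modulo `a`, coordinate by coordinate. -/
theorem IsWeaklyRegular.exists_eq_smul_of_smul_eq_smul {l : List R}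
    (h : IsWeaklyRegular R (a :: b :: l)) {x y : ι → R} (hxy : b • x = a • y) :
    ∃ w : ι → R, x = a • w := by
  have h1 := h.regular_mod_prev 1 (by simp)
  rw [isSMulRegular_quotient_iff_mem_of_smul_mem] at h1
  have h2 : ∀ i, ∃ w, x i = a * w := fun i => by
    have h3 : x i ∈ Ideal.ofList ((a :: b :: l).take 1) • (⊤ : Submodule R R) := by
      refine h1 (x i) ?_
      have := congrFun hxy i
      simp only [Pi.smul_apply, smul_eq_mul] at this
      simp [Ideal.mem_span_singleton, this]
    simpa [Ideal.mem_span_singleton, Dvd.dvd] using h3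
  choose w hw using h2
  exact ⟨w, funext hw⟩

theorem IsWeaklyRegular.exists_eq_smul_add_smul_of_smul_eq {l : List R}
    (h : IsWeaklyRegular R (a :: b :: c :: l)) {u p q : ι → R} (hu : c • u = a • p + b • q) :
    ∃ s t : ι → R, u = a • s + b • t := by
  have h1 := h.regular_mod_prev 2 (by simp)
  rw [isSMulRegular_quotient_iff_mem_of_smul_mem] at h1
  have hmem : ∀ z : R, z ∈ Ideal.ofList ((a :: b :: c :: l).take 2) • (⊤ : Submodule R R) ↔
      ∃ s t, z = a * s + b * t := fun z => by
    simp only [List.take_succ_cons, List.take_zero, Ideal.ofList_cons, Ideal.ofList_nil,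
      sup_bot_eq, smul_eq_mul, Ideal.mul_top, ← Ideal.span_insert, Ideal.mem_span_pair]
    constructor <;> rintro ⟨s, t, h⟩ <;> exact ⟨s, t, by linear_combination -h⟩
  have h2 : ∀ i, ∃ s t, u i = a * s + b * t := fun i => by
    refine (hmem _).mp (h1 (u i) ((hmem _).mpr ⟨p i, q i, ?_⟩))
    simpa using congrFun hu i
  choose s t hst using h2
  exact ⟨s, t, funext hst⟩

/-- The image of an injective homomorphism of free modules is saturated with respect to
ideals of grade at least two. -/
theorem IsWeaklyRegular.mem_range_of_injective {l : List R} (h : IsWeaklyRegular R (a :: b :: l))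
    {s : (κ → R) →ₗ[R] (ι → R)} (hs : Function.Injective s) {x : ι → R}
    (hax : a • x ∈ LinearMap.range s) (hbx : b • x ∈ LinearMap.range s) :
    x ∈ LinearMap.range s := by
  obtain ⟨p, hp⟩ := hax
  obtain ⟨q, hq⟩ := hbx
  -- Both sides are sent by `s` to `(a * b) • x`.
  have h1 : b • p = a • q := hs (by rw [map_smul, map_smul, hp, hq, smul_comm])
  obtain ⟨w, rfl⟩ := IsWeaklyRegular.exists_eq_smul_of_smul_eq_smul h h1
  refine ⟨w, IsWeaklyRegular.smul_left_injective_pi h ?_⟩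
  rw [← hp, map_smul]

/-- The image of a homomorphism of free modules with free kernel is saturated with respect to
ideals of grade at least three. -/
theorem IsWeaklyRegular.mem_range_of_exact {l : List R}
    (h : IsWeaklyRegular R (a :: b :: c :: l))
    {s : (κ → R) →ₗ[R] (ι → R)} (hs : Function.Injective s)
    {f : (ι → R) →ₗ[R] (μ → R)} (hfs : LinearMap.ker f = LinearMap.range s) {F : μ → R}
    (ha : a • F ∈ LinearMap.range f) (hb : b • F ∈ LinearMap.range f)
    (hc : c • F ∈ LinearMap.range f) : F ∈ LinearMap.range f := by
  obtain ⟨x, hx⟩ := ha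
  obtain ⟨y, hy⟩ := hb
  obtain ⟨z, hz⟩ := hc
  have key : ∀ w ∈ LinearMap.ker f, ∃ u, s u = w := fun w hw => by rwa [hfs] at hw
  -- Formally `x / a`, `y / b`, `z / c` are three preimages of `F`. Their differences, cleared of
  -- denominators, lie in the kernel of `f`.
  obtain ⟨u, hu⟩ := key (b • x - a • y) (by simp [hx, hy, smul_comm a b])
  obtain ⟨u', hu'⟩ := key (c • x - a • z) (by simp [hx, hz, smul_comm a c])
  obtain ⟨u'', hu''⟩ := key (c • y - b • z) (by simp [hy, hz, smul_comm b c])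
  -- The cocycle relation among the three differences, pulled back along the injective `s`.
  have h1 : c • u = a • (-u'') + b • u' := hs (by
    simp only [map_add, map_smul, map_neg, hu, hu', hu'']
    module)
  obtain ⟨p, q, rfl⟩ := IsWeaklyRegular.exists_eq_smul_add_smul_of_smul_eq h h1
  -- After correction by kernel elements the fractions `(x - s q) / a` and `(y + s p) / b` agree, so
  -- their common value is a genuine vector `w`.
  have h2 : b • (x - s q) = a • (y + s p) := by
    rw [map_add, map_smul, map_smul] at hu
    rw [smul_sub, smul_add, sub_eq_iff_eq_add, add_assoc, hu]
    abel
  obtain ⟨w, hw⟩ := IsWeaklyRegular.exists_eq_smul_of_smul_eq_smul h h2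
  refine ⟨w, IsWeaklyRegular.smul_left_injective_pi h ?_⟩
  have h3 : f (s q) = 0 := by
    have : s q ∈ LinearMap.ker f := hfs ▸ ⟨q, rfl⟩
    exact this
  rw [← map_smul, ← hw, map_sub, hx, h3, sub_zero]

end Saturation

/-! ### Cramer's rule for polynomial matrices of constant rank -/

section PolynomialMatrices

open MvPolynomial RingTheory.Sequence

variable {k : Type*} [Field k]

/-- The columns of `P` are preimages of a basis of the image of `A`, and `Q` takes coordinates after
a projection onto that image. The compression is then the identity. -/
theorem exists_det_compression_ne_zero {ι μ : Type*} [Fintype ι] [Fintype μ] [DecidableEq μ]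
    [DecidableEq ι] (A : Matrix μ ι k) :
    ∃ (P : Matrix ι (Fin A.rank) k) (Q : Matrix (Fin A.rank) μ k), (Q * A * P).det ≠ 0 := by
  let W := LinearMap.range A.mulVecLin
  let b : Module.Basis (Fin A.rank) k W := Module.finBasisOfFinrankEq k W rfl
  have hb : ∀ j, ∃ c : ι → k, A.mulVecLin c = b j := fun j => (b j).2
  choose c hc using hb
  obtain ⟨π, hπ⟩ := W.subtype.exists_leftInverse_of_injective W.ker_subtype
  refine ⟨Matrix.of fun i j => c j i, LinearMap.toMatrix' (b.equivFun.toLinearMap ∘ₗ π), ?_⟩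
  suffices h : LinearMap.toMatrix' (b.equivFun.toLinearMap ∘ₗ π) * A *
      (Matrix.of fun i j => c j i) = 1 by simp [h]
  apply Matrix.toLin'.injective
  apply (Pi.basisFun k _).ext
  intro j
  have h1 : (Matrix.of fun i j => c j i).mulVec (Pi.single j 1) = c j := by
    ext i; simp
  have h2 : A.mulVec (c j) = b j := hc j
  have h3 : π (b j) = b j := LinearMap.congr_fun hπ (b j)
  rw [Matrix.toLin'_mul, Matrix.toLin'_mul]
  simp only [LinearMap.comp_apply, Matrix.toLin'_apply, Pi.basisFun_apply, h1, h2,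
    LinearMap.toMatrix'_mulVec, h3, Matrix.one_mulVec]
  ext i
  simp [Pi.single_apply, eq_comm]

/-- Cramer's rule: by equality of ranks `A * P` has the same image as `A`, so `F = (A * P) y`, and
the adjugate recovers `det • y` from `Q F`. -/
theorem det_smul_eq_mulVec_adjugate {ι μ : Type*} [Fintype ι] [Fintype μ] {r : ℕ}
    {A : Matrix μ ι k} (hA : A.rank = r) {P : Matrix ι (Fin r) k} {Q : Matrix (Fin r) μ k}
    (hdet : (Q * A * P).det ≠ 0) {F : μ → k} (hF : F ∈ LinearMap.range A.mulVecLin) :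
    (Q * A * P).det • F = A.mulVec (P.mulVec ((Q * A * P).adjugate.mulVec (Q.mulVec F))) := by
  have hinj : Function.Injective (A * P).mulVecLin := by
    intro x y hxy
    have h1 : (A * P).mulVec x = (A * P).mulVec y := hxy
    have h2 : (Q * A * P).mulVec x = (Q * A * P).mulVec y := by
      rw [Matrix.mul_assoc, ← Matrix.mulVec_mulVec, h1, Matrix.mulVec_mulVec]
    exact Matrix.mulVec_injective_of_isUnit
      ((Matrix.isUnit_iff_isUnit_det _).mpr (isUnit_iff_ne_zero.mpr hdet)) h2
  have hle : LinearMap.range (A * P).mulVecLin ≤ LinearMap.range A.mulVecLin := by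
    rw [Matrix.mulVecLin_mul]
    exact LinearMap.range_comp_le_range _ _
  have heq : LinearMap.range (A * P).mulVecLin = LinearMap.range A.mulVecLin := by
    refine Submodule.eq_of_le_of_finrank_eq hle ?_
    rw [LinearMap.finrank_range_of_inj hinj, Module.finrank_fin_fun]
    exact hA.symm
  rw [← heq] at hF
  obtain ⟨y, rfl⟩ := hF
  have h1 : Q.mulVec ((A * P).mulVecLin y) = (Q * A * P).mulVec y := by
    simp [Matrix.mul_assoc]
  rw [h1, Matrix.mulVec_mulVec, Matrix.mulVec_mulVec y (Q * A * P).adjugate,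
    Matrix.adjugate_mul, Matrix.smul_mulVec, Matrix.one_mulVec, Matrix.mulVec_smul]
  rfl

variable {σ ι μ : Type*} [Fintype ι]

theorem eval_mulVec (v : σ → k) (A : Matrix μ ι (MvPolynomial σ k)) (x : ι → MvPolynomial σ k)
    (i : μ) : eval v (A.mulVec x i) = (A.map (eval v)).mulVec (fun j => eval v (x j)) i := by
  simp [Matrix.mulVec, dotProduct]

/-- A compression by constant matrices chosen at `u` has a polynomial determinant, which serves as
`q`. Cramer's rule holds at the points of `U` where `q` does not vanish, and density turns it into a
polynomial identity. -/
theorem exists_eval_ne_zero_smul_mem_range [Fintype μ] {U : Set (σ → k)}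
    (hU : ∀ p : MvPolynomial σ k, (∀ u ∈ U, eval u p = 0) → p = 0)
    (A : Matrix μ ι (MvPolynomial σ k)) {r : ℕ} (hA : ∀ u ∈ U, (A.map (eval u)).rank = r)
    {F : μ → MvPolynomial σ k}
    (hF : ∀ u ∈ U, (fun i => eval u (F i)) ∈ LinearMap.range (A.map (eval u)).mulVecLin)
    {u : σ → k} (hu : u ∈ U) :
    ∃ q : MvPolynomial σ k, q • F ∈ LinearMap.range A.mulVecLin ∧ eval u q ≠ 0 := by
  classical
  obtain ⟨P, Q, hPQ⟩ := exists_det_compression_ne_zero (A.map (eval u))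
  obtain rfl := hA u hu
  let P' : Matrix ι (Fin (A.map (eval u)).rank) (MvPolynomial σ k) := P.map C
  let Q' : Matrix (Fin (A.map (eval u)).rank) μ (MvPolynomial σ k) := Q.map C
  have hP : ∀ v, P'.map (eval v) = P := fun v => by ext i j; simp [P']
  have hQ : ∀ v, Q'.map (eval v) = Q := fun v => by ext i j; simp [Q']
  let D := Q' * A * P'
  let G := P'.mulVec (D.adjugate.mulVec (Q'.mulVec F))
  have hD : ∀ v, D.map (eval v) = Q * A.map (eval v) * P := fun v => by
    rw [Matrix.map_mul, Matrix.map_mul, hP, hQ]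
  have hdet : ∀ v, eval v D.det = (Q * A.map (eval v) * P).det := fun v => by
    rw [RingHom.map_det, ← hD]; rfl
  have hadj : ∀ v, D.adjugate.map (eval v) = (Q * A.map (eval v) * P).adjugate := fun v => by
    rw [← hD]; exact RingHom.map_adjugate (eval v) D
  have hD0 : D.det ≠ 0 := fun h => hPQ (by rw [← hdet, h, map_zero])
  refine ⟨D.det, ⟨G, ?_⟩, by rwa [hdet]⟩
  ext1 i
  -- The additional factor `D.det` makes the identity trivial at points where the compression
  -- degenerates.
  refine mul_left_cancel₀ hD0 (sub_eq_zero.mp (hU _ fun v hv => ?_))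
  by_cases h0 : eval v D.det = 0
  · simp [h0]
  have h1 := det_smul_eq_mulVec_adjugate (hA v hv) (hdet v ▸ h0) (hF v hv)
  have h2 : eval v (A.mulVec G i) = eval v D.det * eval v (F i) := by
    simp only [eval_mulVec, G, hP, hQ, hadj, hdet]
    exact (congrFun h1 i).symm
  rw [← mul_sub, map_mul, map_sub, Matrix.mulVecLin_apply, h2]
  simp

end PolynomialMatrices

/-! ### Extension across closed subsets of large codimension -/

section RegularExtension

open MvPolynomial RingTheory.Sequence

variable {k : Type*} [Field k] {n : ℕ} {U : Set (Fin n → k)}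

/-- Some nonzero `q` vanishes off `U`, so `q * p` vanishes everywhere. -/
theorem eq_zero_of_eval_eq_zero_of_one_le_height [Infinite k]
    (hU : 1 ≤ (MvPolynomial.vanishingIdeal k Uᶜ).height)
    {p : MvPolynomial (Fin n) k} (hp : ∀ u ∈ U, eval u p = 0) : p = 0 := by
  have h0 : MvPolynomial.vanishingIdeal k Uᶜ ≠ ⊥ := by
    intro h
    rw [h, Ideal.height_bot] at hU
    simp at hU
  obtain ⟨q, hq, hq0⟩ := Submodule.exists_mem_ne_zero_of_ne_bot h0
  refine (mul_eq_zero.mp (MvPolynomial.funext fun v => ?_ : q * p = 0)).resolve_left hq0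
  by_cases hv : v ∈ U
  · simp [hp v hv]
  · have : eval v q = 0 := by simpa [coe_aeval_eq_eval] using hq v hv
    simp [this]

/-- The zeros of `I` lie outside `U`, so by the Nullstellensatz the radical of `I` contains the
vanishing ideal of the complement. Passing to the radical does not change the height. -/
theorem exists_isWeaklyRegular_of_forall_exists_eval_ne_zero [IsAlgClosed k] {t : ℕ}
    (hU : (t : ℕ∞) ≤ (MvPolynomial.vanishingIdeal k Uᶜ).height)
    {I : Ideal (MvPolynomial (Fin n) k)} (hI : ∀ u ∈ U, ∃ q ∈ I, eval u q ≠ 0) :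
    ∃ rs : List (MvPolynomial (Fin n) k), rs.length = t ∧ (∀ r ∈ rs, r ∈ I) ∧
      IsWeaklyRegular (MvPolynomial (Fin n) k) rs := by
  refine exists_isWeaklyRegular_of_le_height t I (hU.trans ?_)
  have h1 : zeroLocus k I ⊆ Uᶜ := fun v hv hvU => by
    obtain ⟨q, hq, hq0⟩ := hI v hvU
    exact hq0 (by simpa [coe_aeval_eq_eval] using hv q hq)
  have h2 := vanishingIdeal_anti_mono (k := k) h1
  rw [vanishingIdeal_zeroLocus_eq_radical] at h2
  exact (Ideal.height_mono h2).trans_eq (by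
    rw [Ideal.height_eq_inf_minimalPrimes, Ideal.radical_minimalPrimes,
      ← Ideal.height_eq_inf_minimalPrimes])

/-- A function which is regular on the complement of a closed subset of codimension at least two
extends to a polynomial. -/
theorem exists_polynomial_eqOn_of_regular [IsAlgClosed k]
    (hU : 2 ≤ (MvPolynomial.vanishingIdeal k Uᶜ).height) {s : (Fin n → k) → k}
    (hs : ∀ u ∈ U, ∃ p q : MvPolynomial (Fin n) k, eval u q ≠ 0 ∧
      ∀ w ∈ U, eval w q ≠ 0 → s w = eval w p / eval w q) :
    ∃ P : MvPolynomial (Fin n) k, ∀ u ∈ U, s u = eval u P := by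
  have := IsAlgClosed.instInfinite (K := k)
  have hdense : ∀ {p : MvPolynomial (Fin n) k}, (∀ u ∈ U, eval u p = 0) → p = 0 := fun hp =>
    eq_zero_of_eval_eq_zero_of_one_le_height (le_trans (by norm_num) hU) hp
  -- The ideal of denominators of `s`.
  let D : Ideal (MvPolynomial (Fin n) k) :=
    { carrier := {q | ∃ p, ∀ w ∈ U, eval w q * s w = eval w p}
      zero_mem' := ⟨0, by simp⟩
      add_mem' := by
        rintro q q' ⟨p, hp⟩ ⟨p', hp'⟩
        exact ⟨p + p', fun w hw => by simp [add_mul, hp w hw, hp' w hw]⟩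
      smul_mem' := by
        rintro c q ⟨p, hp⟩
        exact ⟨c * p, fun w hw => by simp [mul_assoc, hp w hw]⟩ }
  have hD : ∀ u ∈ U, ∃ q ∈ D, eval u q ≠ 0 := fun u hu => by
    obtain ⟨p, q, hq, h⟩ := hs u hu
    -- Squaring the denominator makes the identity hold also where `q` vanishes, since there nothing
    -- is known about `s`.
    refine ⟨q * q, ⟨q * p, fun w hw => ?_⟩, by simpa using hq⟩
    by_cases h0 : eval w q = 0
    · simp [h0]
    · rw [h w hw h0]
      simp only [map_mul]
      field_simp
  obtain ⟨rs, hlen, hrs, hreg⟩ := exists_isWeaklyRegular_of_forall_exists_eval_ne_zero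
    (t := 2) (by exact_mod_cast hU) hD
  obtain ⟨a, b, rfl⟩ := List.length_eq_two.mp hlen
  obtain ⟨pa, hpa⟩ := hrs a (by simp)
  obtain ⟨pb, hpb⟩ := hrs b (by simp)
  have h1 : b * pa = a * pb := sub_eq_zero.mp (hdense fun w hw => by
    simp only [map_sub, map_mul, ← hpa w hw, ← hpb w hw]
    ring)
  obtain ⟨P, hP⟩ := IsWeaklyRegular.exists_eq_smul_of_smul_eq_smul (ι := Unit) hreg
    (x := fun _ => pa) (y := fun _ => pb) (funext fun _ => h1)
  replace hP : pa = a * P () := congrFun hP ()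
  refine ⟨P (), fun u hu => ?_⟩
  obtain ⟨q, ⟨p, hp⟩, hq⟩ := hD u hu
  -- `P` was built from the denominators `a` and `b`, which may both vanish at `u`. Comparison with
  -- a denominator `q` that is nonzero at `u` shows that `P` has the right value there.
  have h2 : q * P () = p := by
    have h3 : a * (q * P ()) = a * p := by
      rw [mul_left_comm, ← hP]
      refine sub_eq_zero.mp (hdense fun w hw => ?_)
      simp only [map_sub, map_mul, ← hpa w hw, ← hp w hw]
      ring
    exact ((isWeaklyRegular_cons_iff _ _ _).mp hreg).1 h3
  refine mul_left_cancel₀ hq ?_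
  rw [hp u hu, ← h2, map_mul]

/-- Let `A` be a matrix of polynomials whose kernels over the points of `U` form a trivial bundle,
where the complement of `U` has codimension at least three. Then every polynomial vector which is
over `U` pointwise in the image of `A` is in the image of `A`. -/
theorem mem_range_mulVecLin_of_trivial_kernel [IsAlgClosed k] {ι μ : Type*} [Fintype ι] [Fintype μ]
    {m : ℕ} (hU : 3 ≤ (MvPolynomial.vanishingIdeal k Uᶜ).height)
    (A : Matrix μ ι (MvPolynomial (Fin n) k)) (s : Fin m → (Fin n → k) → ι → k)
    (hs : ∀ j i, ∀ u ∈ U, ∃ p q : MvPolynomial (Fin n) k, eval u q ≠ 0 ∧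
      ∀ w ∈ U, eval w q ≠ 0 → s j w i = eval w p / eval w q)
    (hli : ∀ u ∈ U, LinearIndependent k fun j => s j u)
    (hspan : ∀ u ∈ U, Submodule.span k (Set.range fun j => s j u) =
      LinearMap.ker (A.map (eval u)).mulVecLin)
    {F : μ → MvPolynomial (Fin n) k}
    (hF : ∀ u ∈ U, (fun i => eval u (F i)) ∈ LinearMap.range (A.map (eval u)).mulVecLin) :
    F ∈ LinearMap.range A.mulVecLin := by
  classical
  have := IsAlgClosed.instInfinite (K := k)
  have hdense : ∀ p : MvPolynomial (Fin n) k, (∀ u ∈ U, eval u p = 0) → p = 0 := fun p hp =>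
    eq_zero_of_eval_eq_zero_of_one_le_height (le_trans (by norm_num) hU) hp
  have hext : ∀ i j, ∃ P : MvPolynomial (Fin n) k, ∀ u ∈ U, s j u i = eval u P := fun i j =>
    exists_polynomial_eqOn_of_regular (le_trans (by norm_num) hU) (hs j i)
  choose S hS using hext
  let S : Matrix ι (Fin m) (MvPolynomial (Fin n) k) := Matrix.of S
  have hSu : ∀ u ∈ U, ∀ c : Fin m → k,
      (S.map (eval u)).mulVec c = ∑ j, c j • s j u := fun u hu c => by
    ext i
    simp [Matrix.mulVec, dotProduct, S, ← hS _ _ u hu, mul_comm]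
  have hSinj : ∀ u ∈ U, Function.Injective (S.map (eval u)).mulVecLin := fun u hu => by
    rw [← LinearMap.ker_eq_bot, LinearMap.ker_eq_bot']
    intro c hc
    rw [Matrix.mulVecLin_apply, hSu u hu] at hc
    exact funext (Fintype.linearIndependent_iff.mp (hli u hu) c hc)
  have hSrange : ∀ u ∈ U, LinearMap.range (S.map (eval u)).mulVecLin =
      LinearMap.ker (A.map (eval u)).mulVecLin := fun u hu => by
    rw [← hspan u hu, Matrix.range_mulVecLin]
    congr 2
    ext j i
    simp [S, hS _ _ u hu]
  have hrankS : ∀ u ∈ U, (S.map (eval u)).rank = m := fun u hu => by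
    rw [Matrix.rank, LinearMap.finrank_range_of_inj (hSinj u hu), Module.finrank_fin_fun]
  -- Rank–nullity: the frame gives every kernel over `U` dimension `m`.
  have hrankA : ∀ u ∈ U, (A.map (eval u)).rank = Fintype.card ι - m := fun u hu => by
    have h1 := LinearMap.finrank_range_add_finrank_ker (A.map (eval u)).mulVecLin
    rw [← hSrange u hu, Module.finrank_pi] at h1
    have h2 := hrankS u hu
    rw [Matrix.rank] at h2 ⊢
    omega
  have hSinj' : Function.Injective S.mulVecLin := by
    rw [← LinearMap.ker_eq_bot, LinearMap.ker_eq_bot']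
    intro c hc
    ext1 j
    refine hdense _ fun u hu => ?_
    have h1 : (S.map (eval u)).mulVecLin (fun j => eval u (c j)) = 0 := by
      ext i
      rw [Matrix.mulVecLin_apply, ← eval_mulVec, ← Matrix.mulVecLin_apply, hc]
      simp
    exact congrFun (hSinj u hu (h1.trans (map_zero _).symm)) j
  have hker : LinearMap.ker A.mulVecLin = LinearMap.range S.mulVecLin := by
    apply le_antisymm
    · intro x hx
      have hx' : ∀ u ∈ U, (fun i => eval u (x i)) ∈
          LinearMap.range (S.map (eval u)).mulVecLin := fun u hu => by
        rw [hSrange u hu, LinearMap.mem_ker]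
        ext i
        rw [Matrix.mulVecLin_apply, ← eval_mulVec, ← Matrix.mulVecLin_apply,
          LinearMap.mem_ker.mp hx]
        simp
      -- Since `S` is injective and has constant rank on `U`, grade two suffices to bring a kernel
      -- element into its image.
      obtain ⟨rs, hlen, hrs, hreg⟩ := exists_isWeaklyRegular_of_forall_exists_eval_ne_zero
        (t := 2) (le_trans (by norm_num) hU)
        (I := (LinearMap.range S.mulVecLin).comap (LinearMap.toSpanSingleton _ _ x))
        fun u hu => exists_eval_ne_zero_smul_mem_range hdense S hrankS hx' hu
      obtain ⟨a, b, rfl⟩ := List.length_eq_two.mp hlen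
      exact IsWeaklyRegular.mem_range_of_injective hreg hSinj' (hrs a (by simp))
        (hrs b (by simp))
    · rintro _ ⟨c, rfl⟩
      rw [LinearMap.mem_ker]
      ext1 i
      refine hdense _ fun u hu => ?_
      have h1 : (S.map (eval u)).mulVecLin (fun j => eval u (c j)) ∈
          LinearMap.ker (A.map (eval u)).mulVecLin := hSrange u hu ▸ ⟨_, rfl⟩
      have h2 := congrFun (LinearMap.mem_ker.mp h1) i
      rw [Matrix.mulVecLin_apply, eval_mulVec, Matrix.mulVecLin_apply]
      simp only [eval_mulVec]
      exact h2
  -- `A` has the kernel im S, so grade three is needed here.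
  obtain ⟨rs, hlen, hrs, hreg⟩ := exists_isWeaklyRegular_of_forall_exists_eval_ne_zero
    (t := 3) (by exact_mod_cast hU)
    (I := (LinearMap.range A.mulVecLin).comap (LinearMap.toSpanSingleton _ _ F))
    fun u hu => exists_eval_ne_zero_smul_mem_range hdense A hrankA hF hu
  obtain ⟨a, b, c, rfl⟩ := List.length_eq_three.mp hlen
  exact IsWeaklyRegular.mem_range_of_exact hreg hSinj' hker (hrs a (by simp)) (hrs b (by simp))
    (hrs c (by simp))

end RegularExtension

/-! ### Polynomial functions and maps in coordinates -/

section Coordinates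

open MvPolynomial

variable {k : Type*} [Field k] {V : Type*} [AddCommGroup V] [Module k V] {n : ℕ}
  (b : Module.Basis (Fin n) k V)

/-- The polynomial function on `V` given by a polynomial in the coordinates of a basis. -/
noncomputable def evalCoord : MvPolynomial (Fin n) k →ₐ[k] V → k :=
  aeval fun i v => b.repr v i

theorem evalCoord_apply (p : MvPolynomial (Fin n) k) (v : V) :
    evalCoord b p v = eval (b.equivFun v) p := by
  have h : (Pi.evalAlgHom k (fun _ : V => k) v).comp (evalCoord b) = aeval (b.equivFun v) := by
    ext i
    simp [evalCoord]
  rw [← coe_aeval_eq_eval]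
  exact DFunLike.congr_fun h p

theorem range_evalCoord : (evalCoord b).range = PolyFun k V := by
  rw [evalCoord, ← Algebra.adjoin_range_eq_range_aeval]
  apply le_antisymm
  · refine Algebra.adjoin_mono ?_
    rintro _ ⟨i, rfl⟩
    exact ⟨b.coord i, rfl⟩
  · refine Algebra.adjoin_le ?_
    rintro _ ⟨l, rfl⟩
    have h : (l : V → k) = ∑ i, l (b i) • fun v => b.repr v i := by
      ext v
      conv_lhs => rw [← b.sum_repr v, map_sum]
      simp [mul_comm]
    change (l : V → k) ∈ _
    rw [h]
    exact Subalgebra.sum_mem _ fun i _ =>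
      Subalgebra.smul_mem _ (Algebra.subset_adjoin (Set.mem_range_self i)) _

theorem mem_polyFun_iff {f : V → k} :
    f ∈ PolyFun k V ↔ ∃ p : MvPolynomial (Fin n) k, ∀ v, f v = eval (b.equivFun v) p := by
  rw [← range_evalCoord b, AlgHom.mem_range]
  refine exists_congr fun p => ?_
  rw [funext_iff]
  refine forall_congr' fun v => ?_
  rw [evalCoord_apply, eq_comm]

theorem evalCoord_injective [Infinite k] : Function.Injective (evalCoord b) := by
  intro p q h
  refine MvPolynomial.funext fun x => ?_
  have := congrFun h (b.equivFun.symm x)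
  simpa only [evalCoord_apply, LinearEquiv.apply_symm_apply] using this

/-- The identification of `k[V]` with a polynomial ring by means of a basis. -/
noncomputable def polyFunEquiv [Infinite k] : MvPolynomial (Fin n) k ≃ₐ[k] PolyFun k V :=
  (AlgEquiv.ofInjective _ (evalCoord_injective b)).trans
    (Subalgebra.equivOfEq _ _ (range_evalCoord b))

theorem polyFunEquiv_apply [Infinite k] (p : MvPolynomial (Fin n) k) (v : V) :
    (polyFunEquiv b p : V → k) v = eval (b.equivFun v) p :=
  evalCoord_apply b p v

theorem codim_eq_height_vanishingIdeal [Infinite k] (Z : Set V) :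
    codim k V Z = (MvPolynomial.vanishingIdeal k (b.equivFun.symm ⁻¹' Z)).height := by
  rw [codim, ← RingEquiv.height_comap (polyFunEquiv b).toRingEquiv]
  congr 1
  ext p
  rw [Ideal.mem_comap]
  have h1 : (∀ z ∈ Z, (polyFunEquiv b p : V → k) z = 0) ↔
      ∀ x ∈ b.equivFun.symm ⁻¹' Z, aeval x p = 0 := by
    simp only [polyFunEquiv_apply, Set.mem_preimage]
    constructor
    · intro h x hx
      have := h _ hx
      rwa [LinearEquiv.apply_symm_apply] at this
    · intro h z hz
      exact h _ (by simpa only [LinearEquiv.symm_apply_apply] using hz)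
  exact h1

theorem mem_mor_iff {N : Type*} [AddCommGroup N] [Module k N] {ι : Type*} [Fintype ι]
    (c : Module.Basis ι k N) {F : V → N} :
    F ∈ Mor k V N ↔
      ∃ P : ι → MvPolynomial (Fin n) k, ∀ v i, c.equivFun (F v) i = eval (b.equivFun v) (P i) := by
  constructor
  · intro h
    have h1 : ∀ i, ∃ p : MvPolynomial (Fin n) k, ∀ v, c.coord i (F v) = eval (b.equivFun v) p :=
      fun i => (mem_polyFun_iff b).mp (h (c.coord i))
    choose P hP using h1
    exact ⟨P, fun v i => hP i v⟩
  · rintro ⟨P, hP⟩ l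
    refine (mem_polyFun_iff b).mpr ⟨∑ i, C (l (c i)) * P i, fun v => ?_⟩
    conv_lhs => rw [← c.sum_equivFun (F v), map_sum]
    simp only [map_smul, hP, map_sum, map_mul, eval_C, smul_eq_mul, mul_comm]

end Coordinates

/-! ### The matrix of the infinitesimal action -/

section Action

open MvPolynomial

variable {k : Type*} [Field k] {g : Type*} [LieRing g] [LieAlgebra k g]
  {V : Type*} [AddCommGroup V] [Module k V] [LieRingModule g V] [LieModule k g V]
  {n : ℕ} (b : Module.Basis (Fin n) k V) {ι : Type*} [Fintype ι] (c : Module.Basis ι k g)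

/-- The matrix, with linear polynomials as entries, of the orbit maps `g → V`, `x ↦ x · v`. -/
noncomputable def orbitMatrix : Matrix (Fin n) ι (MvPolynomial (Fin n) k) :=
  Matrix.of fun i j => ∑ l, C (b.repr ⁅c j, b l⁆ i) * X l

theorem orbitMatrix_map_eval_mulVec (v : V) (x : g) :
    ((orbitMatrix b c).map (eval (b.equivFun v))).mulVec (c.equivFun x) = b.equivFun ⁅x, v⁆ := by
  ext i
  have h1 : ∀ j, ⁅c j, v⁆ = ∑ l, b.repr v l • ⁅c j, b l⁆ := fun j => by
    have := congrArg (LieModule.toEnd k g V (c j)) (b.sum_repr v)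
    rw [map_sum] at this
    simp only [map_smul] at this
    exact this.symm
  have h2 : ⁅x, v⁆ = ∑ j, c.repr x j • ⁅c j, v⁆ := by
    have := congrArg (orbitMap k g v) (c.sum_repr x)
    rw [map_sum] at this
    simp only [map_smul] at this
    exact this.symm
  rw [h2]
  simp only [h1, orbitMatrix, Matrix.mulVec, dotProduct, Matrix.map_apply, Matrix.of_apply,
    map_sum, map_mul, eval_C, eval_X, map_smul, Finset.sum_apply, Pi.smul_apply, smul_eq_mul,
    Module.Basis.equivFun_apply]
  refine Finset.sum_congr rfl fun j _ => ?_
  rw [mul_comm]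
  congr 1
  exact Finset.sum_congr rfl fun l _ => mul_comm _ _

theorem map_stabiliser_equivFun (v : V) :
    (stabiliser k g v).map c.equivFun.toLinearMap =
      LinearMap.ker ((orbitMatrix b c).map (eval (b.equivFun v))).mulVecLin := by
  ext y
  obtain ⟨x, rfl⟩ := c.equivFun.surjective y
  rw [LinearMap.mem_ker, Matrix.mulVecLin_apply, orbitMatrix_map_eval_mulVec,
    LinearEquiv.map_eq_zero_iff]
  exact c.equivFun.injective.mem_set_image

end Action

/-- `mem_range_mulVecLin_of_trivial_kernel` for the orbit matrix, translated back from coordinates.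
The set `U` can be arbitrary because the frame already forces constant rank. -/
theorem exists_mem_mor_of_forall_mem_tangent {k : Type*} [Field k] [IsAlgClosed k]
    {g : Type*} [LieRing g] [LieAlgebra k g] [Module.Finite k g]
    {V : Type*} [AddCommGroup V] [Module k V] [Module.Finite k V]
    [LieRingModule g V] [LieModule k g V] {U : Set V}
    (htriv : IsTrivialSubbundle k U (fun v : V => stabiliser k g v))
    (hcodim : 3 ≤ codim k V Uᶜ) {F : V → V} (hF : F ∈ Mor k V V)
    (hFU : ∀ v ∈ U, F v ∈ tangent k g v) : ∃ F' ∈ Mor k V g, ∀ v : V, F v = ⁅F' v, v⁆ := by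
  have := IsAlgClosed.instInfinite (K := k)
  let b := Module.finBasis k V
  let c := Module.finBasis k g
  obtain ⟨m, s, hs, hsU⟩ := htriv
  obtain ⟨P, hP⟩ := (mem_mor_iff b b).mp hF
  rw [codim_eq_height_vanishingIdeal b, Set.preimage_compl] at hcodim
  have hb : ∀ x, b.equivFun (b.equivFun.symm x) = x := b.equivFun.apply_symm_apply
  obtain ⟨G, hG⟩ := mem_range_mulVecLin_of_trivial_kernel hcodim (orbitMatrix b c)
    (fun j x => c.equivFun (s j (b.equivFun.symm x)))
    (by
      intro j i u hu
      obtain ⟨p, hp, q, hq, hqu, h⟩ := hs j (c.coord i) _ hu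
      obtain ⟨p, hp⟩ := (mem_polyFun_iff b).mp hp
      obtain ⟨q, hq⟩ := (mem_polyFun_iff b).mp hq
      refine ⟨p, q, by rwa [hq, hb] at hqu, fun w hw hqw => ?_⟩
      have := h _ hw (by rwa [hq, hb])
      rwa [hp, hq, hb] at this)
    (fun u hu => (hsU _ hu).1.map' c.equivFun.toLinearMap (LinearEquiv.ker _))
    (by
      intro u hu
      have h1 := map_stabiliser_equivFun b c (b.equivFun.symm u)
      have h2 : Submodule.span k (Set.range fun j => s j (b.equivFun.symm u)) =
        stabiliser k g (b.equivFun.symm u) := (hsU _ hu).2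
      rw [hb, ← h2, Submodule.map_span, ← Set.range_comp] at h1
      exact h1)
    (F := P) (by
      intro u hu
      obtain ⟨x, hx⟩ := hFU _ hu
      refine ⟨c.equivFun x, ?_⟩
      have h1 := orbitMatrix_map_eval_mulVec b c (b.equivFun.symm u) x
      rw [hb] at h1
      rw [Matrix.mulVecLin_apply, h1]
      ext i
      have h2 : ⁅x, b.equivFun.symm u⁆ = F (b.equivFun.symm u) := hx
      rw [h2, hP, hb])
  refine ⟨fun v => c.equivFun.symm fun i => MvPolynomial.eval (b.equivFun v) (G i),
    (mem_mor_iff b c).mpr ⟨G, fun v i => by rw [LinearEquiv.apply_symm_apply]⟩, fun v => ?_⟩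
  apply b.equivFun.injective
  rw [← orbitMatrix_map_eval_mulVec b c, LinearEquiv.apply_symm_apply]
  ext i
  rw [hP, ← hG, Matrix.mulVecLin_apply, eval_mulVec]

end AdjointFields

theorem proposition3p1 {k : Type*} [Field k] [IsAlgClosed k] [CharZero k]
    {g : Type*} [LieRing g] [LieAlgebra k g] [Module.Finite k g]
    {V : Type*} [AddCommGroup V] [Module k V] [Module.Finite k V]
    [LieRingModule g V] [LieModule k g V]
    (htriv : AdjointFields.IsTrivialSubbundle k (AdjointFields.regularSet k g V)
      (fun v : V => AdjointFields.stabiliser k g v))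
    (hcodim : 3 ≤ AdjointFields.codim k V (AdjointFields.regularSet k g V)ᶜ) :
    (LinearMap.range (AdjointFields.phiHat k g V) : Set (AdjointFields.Mor k V V)) =
        {F | ∀ v : V, F.1 v ∈ AdjointFields.tangent k g v} ∧
      ∀ F ∈ AdjointFields.Mor k V V,
        (∀ v ∈ AdjointFields.regularSet k g V, F v ∈ AdjointFields.tangent k g v) →
          ∃ F' ∈ AdjointFields.Mor k V g, ∀ v : V, F v = ⁅F' v, v⁆ := by
  have key : ∀ F ∈ AdjointFields.Mor k V V,
      (∀ v ∈ AdjointFields.regularSet k g V, F v ∈ AdjointFields.tangent k g v) →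
        ∃ F' ∈ AdjointFields.Mor k V g, ∀ v : V, F v = ⁅F' v, v⁆ := fun F hF hFU =>
    AdjointFields.exists_mem_mor_of_forall_mem_tangent htriv hcodim hF hFU
  refine ⟨Set.Subset.antisymm ?_ fun F hF => ?_, key⟩
  · rintro _ ⟨F, rfl⟩ v
    exact ⟨F.1 v, rfl⟩
  · obtain ⟨F', hF', h⟩ := key F.1 F.2 fun v _ => hF v
    exact ⟨⟨F', hF'⟩, Subtype.ext (funext fun v => (h v).symm)⟩
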